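/- Let $(X,d)$ be a separable, locally compact metric space, $\mu$ a positive Radon measure on $X$ with full support, and $(\mathcal E,\mathbb D)$ a symmetric, regular, strictly local Dirichlet form on $L^2(X,\mu)$ with associated positive self-adjoint operator $L$. Give $\mathbb D$ the inner product $\mathcal E_1(f,g)=\mathcal E(f,g)+\int_X fg\,d\mu$, and identify $\mathbb D\subset L^2(X,\mu)\subset\mathbb D^*$. Strict locality means that $\mathcal E(f,g)=0$ whenever $f,g\in\mathbb D$ have compact support and $g$ is constant on a neighbourhood of the support of $f$. Write $m$ for Lebesgue measure on $\mathbb R$. For an open interval $I\subset\mathbb R$, let $W^{1,2}(I;\mathbb D,\mathbb D^*)$ be the space of $v\in L^2(I;\mathbb D)$ with weak time derivative $v'\in L^2(I;\mathbb D^*)$. For $U\subset X$ open, a function $u:I\times U\to\mathbb R$ is a *local weak solution* of $\partial_t u+Lu=0$ on $I\times U$ if for every compact $K\subset I\times U$ there is $u_K\in W^{1,2}(I;\mathbb D,\mathbb D^*)$ with $u=u_K$ $(m\times\mu)$-a.e. on $K$ such that, for every $\phi\in W^{1,2}(I;\mathbb D,\mathbb D^*)$ with support inside $K$, $$\int_I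 (u_K'(t),\phi(t))_{\mathbb D^*,\mathbb D}\,dt+\int_I\mathcal E(u_K(t),\phi(t))\,dt=0 .$$ For $K\subset U$ compact, a function $\psi:X\to[0,1]$ is a *nice cutoff function for $K$ inside $U$* if $\psi=1$ on $K$, $\psi$ is compactly supported inside $U$, and $\psi f\in\mathbb D$ for every $f\in\mathbb D$. The open set $U$ is *nice* if every compact $K\subset U$ has a nice cutoff function inside $U$. **Lemma (Extension principle).** Let $0<T<\infty$, let $U\subset X$ be open and nice, and let $u$ be a local weak solution on $(0,T)\times U$. Suppose that for every nice cutoff function $\psi$ (for some compact $K\subset U$, inside $U$) we have $\psi u\in L^2([0,T];\mathbb D)$, and $\psi u(t)\to0$ weakly in $L^2(X,\mu)$ as $t\downarrow0$. (As $\psi u$ is only determined up to a null set of times, the limit is taken off null sets of times: for every $f\in L^2(X,\mu)$, $\operatorname{ess\,lim}_{t\downarrow0}\int_X\psi\,u(t)\,f\,d\mu=0$; this is the same as the limit of the $L^2$-continuous version of $\psi u$ on $(0,T)$.) Extend $u$ by setting $u(t)=0$ for $t\le0$. Then $u$ is a local weak solution on $(-\infty,T)\times U$. -/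

import Mathlib

open MeasureTheory Filter Topology Set
open scoped ContDiff

/-- A symmetric, positive (semidefinite) bilinear form on a linear subspace `domain` of
`L²(X, μ)`. -/
structure PosForm {X : Type*} [MeasurableSpace X] (μ : Measure X) where
  domain : Submodule ℝ (Lp ℝ 2 μ)
  form : domain →ₗ[ℝ] domain →ₗ[ℝ] ℝ
  symm : ∀ f g, form f g = form g f
  nonneg : ∀ f, 0 ≤ form f f

namespace PosForm

variable {X : Type*} [MeasurableSpace X] {μ : Measure X} (E : PosForm μ)

/-- `E₁(f, g) = E(f, g) + ⟨f, g⟩_{L²}` is an inner product on the domain. -/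
@[reducible]
noncomputable def core : InnerProductSpace.Core ℝ E.domain where
  inner f g := E.form f g + inner ℝ (f : Lp ℝ 2 μ) (g : Lp ℝ 2 μ)
  conj_inner_symm f g := by
    simp [E.symm g f, real_inner_comm]
  re_inner_nonneg f := by
    have h2 : 0 ≤ inner ℝ (f : Lp ℝ 2 μ) (f : Lp ℝ 2 μ) := real_inner_self_nonneg
    simpa using add_nonneg (E.nonneg f) h2
  add_left f g k := by
    rw [map_add, LinearMap.add_apply, Submodule.coe_add, inner_add_left]
    ring
  smul_left f g r := by
    rw [map_smul, LinearMap.smul_apply, Submodule.coe_smul, real_inner_smul_left]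
    simp [mul_add]
  definite f hf := by
    have h : 0 ≤ E.form f f := E.nonneg f
    have h2 : 0 ≤ inner ℝ (f : Lp ℝ 2 μ) (f : Lp ℝ 2 μ) := real_inner_self_nonneg
    have h3 : inner ℝ (f : Lp ℝ 2 μ) (f : Lp ℝ 2 μ) = 0 := by linarith
    exact Subtype.ext (inner_self_eq_zero.mp h3)

/-- The domain `𝔻` of the form, as a type of its own. Its norm is that of the inner product
`E₁(f, g) = E(f, g) + ∫ f g dμ`, not that of `L²(X, μ)`. -/
def Dom : Type _ := E.domain

noncomputable instance : NormedAddCommGroup E.Dom := E.core.toNormedAddCommGroup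

noncomputable instance : InnerProductSpace ℝ E.Dom := InnerProductSpace.ofCore E.core.toCore

/-- The value `E(f, g)`. -/
def energy (f g : E.Dom) : ℝ := E.form f g

/-- The inclusion of `𝔻` into `L²(X, μ)`, as a linear map. -/
def inclₗ : E.Dom →ₗ[ℝ] Lp ℝ 2 μ := E.domain.subtype

theorem inner_def (f g : E.Dom) :
    inner ℝ f g = E.energy f g + inner ℝ (E.inclₗ f) (E.inclₗ g) := rfl

theorem norm_inclₗ_le (f : E.Dom) : ‖E.inclₗ f‖ ≤ 1 * ‖f‖ := by
  have h : 0 ≤ E.energy f f := E.nonneg f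
  have h1 := E.inner_def f f
  rw [real_inner_self_eq_norm_sq, real_inner_self_eq_norm_sq] at h1
  rw [one_mul]
  exact le_of_sq_le_sq (by linarith) (norm_nonneg f)

/-- The continuous inclusion `𝔻 ↪ L²(X, μ)`. -/
noncomputable def toL2 : E.Dom →L[ℝ] Lp ℝ 2 μ := E.inclₗ.mkContinuous 1 E.norm_inclₗ_le

/-- The inclusion `𝔻 ⊆ L²(X, μ) ⊆ 𝔻*`: the element `f` acts on `𝔻` as `g ↦ ∫ f g dμ`. -/
noncomputable def toDual (f : E.Dom) : StrongDual ℝ E.Dom :=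
  (innerSL ℝ (E.toL2 f)).comp E.toL2

/-- `E` is a (symmetric) Dirichlet form: densely defined, closed (its domain is complete
for the norm of `E₁`), and Markovian (the unit contraction operates on it). -/
structure IsDirichletForm : Prop where
  dense : DenseRange E.toL2
  closed : CompleteSpace E.Dom
  markov : ∀ f : E.Dom, ∃ g : E.Dom,
    (E.toL2 g =ᵐ[μ] fun x => min (max (E.toL2 f x) 0) 1) ∧ E.energy g g ≤ E.energy f f

/-- `E` is regular: `C_c(X) ∩ 𝔻` is dense in `𝔻` for the norm of `E₁`, and dense in `C_c(X)` for
the uniform norm. -/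
structure IsRegular [TopologicalSpace X] : Prop where
  dense_dom : Dense {f : E.Dom | ∃ g : X → ℝ, Continuous g ∧ HasCompactSupport g ∧
    E.toL2 f =ᵐ[μ] g}
  dense_cc : ∀ h : X → ℝ, Continuous h → HasCompactSupport h → ∀ ε > 0,
    ∃ f : E.Dom, ∃ g : X → ℝ, Continuous g ∧ HasCompactSupport g ∧ E.toL2 f =ᵐ[μ] g ∧
      ∀ x, |h x - g x| < ε

/-- `E` is strictly (i.e. strongly) local: `E(f, g) = 0` whenever `f, g ∈ 𝔻` have compact
supports and `g` is constant on a neighbourhood of the support of `f`. -/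
def IsStrictlyLocal [TopologicalSpace X] : Prop :=
  ∀ (f g : E.Dom) (K L N : Set X) (c : ℝ), IsCompact K → IsCompact L → IsOpen N → K ⊆ N →
    (∀ᵐ x ∂μ, x ∉ K → E.toL2 f x = 0) → (∀ᵐ x ∂μ, x ∉ L → E.toL2 g x = 0) →
    (∀ᵐ x ∂μ, x ∈ N → E.toL2 g x = c) → E.energy f g = 0

/-- `v ∈ L²(I; 𝔻)`: strongly measurable and square integrable on the time interval `I`. -/
def MemL2 (I : Set ℝ) (v : ℝ → E.Dom) : Prop := MemLp v 2 (volume.restrict I)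

/-- `v ∈ W^{1,2}(I; 𝔻, 𝔻*)`, with weak time derivative `v'`, for an open interval `I`:
`v ∈ L²(I; 𝔻)`, `v' ∈ L²(I; 𝔻*)` and `∫_I χ v' dt = - ∫_I χ' v dt` in `𝔻*` for all
`χ ∈ C_c^∞(I)`. -/
structure MemW12 (I : Set ℝ) (v : ℝ → E.Dom) (v' : ℝ → StrongDual ℝ E.Dom) : Prop where
  memL2 : E.MemL2 I v
  memL2_deriv : MemLp v' 2 (volume.restrict I)
  weak_deriv : ∀ χ : ℝ → ℝ, ContDiff ℝ ∞ χ → HasCompactSupport χ → tsupport χ ⊆ I →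
    ∫ t in I, χ t • v' t = - ∫ t in I, deriv χ t • E.toDual (v t)

/-- The real-valued function `w` on `I × X` represents the curve `v : I → 𝔻 ⊆ L²(X, μ)`: it is
jointly measurable (up to a null set), and `w(t, ·) = v(t)` for almost every `t ∈ I`. -/
def Represents (I : Set ℝ) (w : ℝ × X → ℝ) (v : ℝ → E.Dom) : Prop :=
  AEStronglyMeasurable w ((volume.restrict I).prod μ) ∧
    ∀ᵐ t ∂(volume.restrict I), (fun x => w (t, x)) =ᵐ[μ] E.toL2 (v t)

/-- `u = v` holds `(m × μ)`-almost everywhere on `S ∩ (I × X)`, where the curve `v : I → 𝔻` is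
viewed as a function on `I × X`. -/
def AEEqOn (I : Set ℝ) (u : ℝ → X → ℝ) (v : ℝ → E.Dom) (S : Set (ℝ × X)) : Prop :=
  ∃ w : ℝ × X → ℝ, E.Represents I w v ∧
    ∀ᵐ p ∂((volume.restrict I).prod μ), p ∈ S → u p.1 p.2 = w p

/-- `u` is a local weak solution on `I × U` of the heat equation `∂ₜu + Lu = 0`, where `I` is an
open interval. Only the values of `u` on `I × U` matter. The test functions `φ` are those with
support inside `K`, i.e. `φ = 0` almost everywhere outside `K`. -/
def IsLocalWeakSolution [TopologicalSpace X] (I : Set ℝ) (U : Set X) (u : ℝ → X → ℝ) : Prop :=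
  ∀ K : Set (ℝ × X), IsCompact K → K ⊆ I ×ˢ U →
    ∃ (v : ℝ → E.Dom) (v' : ℝ → StrongDual ℝ E.Dom), E.MemW12 I v v' ∧ E.AEEqOn I u v K ∧
      ∀ (φ : ℝ → E.Dom) (φ' : ℝ → StrongDual ℝ E.Dom), E.MemW12 I φ φ' →
        E.AEEqOn I 0 φ Kᶜ →
        (∫ t in I, v' t (φ t)) + (∫ t in I, E.energy (v t) (φ t)) = 0

/-- `ψ : X → [0, 1]` is a nice cutoff function for `K` inside `U`. -/
structure IsNiceCutoff [TopologicalSpace X] (ψ : X → ℝ) (K U : Set X) : Prop where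
  mem_Icc : ∀ x, ψ x ∈ Icc (0 : ℝ) 1
  eq_one : ∀ x ∈ K, ψ x = 1
  compact : HasCompactSupport ψ
  support_subset : tsupport ψ ⊆ U
  mul_mem : ∀ f : E.Dom, ∃ g : E.Dom, E.toL2 g =ᵐ[μ] fun x => ψ x * E.toL2 f x

/-- The set `U` is nice: every compact `K ⊆ U` has a nice cutoff function inside `U`. -/
def IsNice [TopologicalSpace X] (U : Set X) : Prop :=
  ∀ K : Set X, IsCompact K → K ⊆ U → ∃ ψ : X → ℝ, E.IsNiceCutoff ψ K U

end PosForm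

/-- `z(t) → 0` weakly in `L²(X, μ)` as `t ↓ 0`. The curve `z` is only determined up to a null set
of times, so the limit is the essential one, taken off null sets of times. It is implied by the
ordinary limit for any version of `z`; if `z` has an `L²`-continuous version on some `(0, T)`, it
is equivalent to the ordinary limit for that version. -/
def WeaklyTendsToZero {X : Type*} [MeasurableSpace X] (μ : Measure X) (z : ℝ → X → ℝ) : Prop :=
  ∀ f : Lp ℝ 2 μ, Tendsto (fun t => ∫ x, z t x * f x ∂μ) (𝓝[>] 0 ⊓ ae volume) (𝓝 0)

/-!
Fix a compact `K ⊆ (-∞, T) × U` with projection `K'` to `X`, and nested nice cutoff functions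
`ψ₀ ≺ ψ₁ ≺ ψ₂ ≺ ψ₃` inside `U`, each equal to `1` on the support of the one before, with `ψ₀ = 1`
near `K'` and `ψ₂ = 1` near the support of `ψ₁`. The function `ψ₁ u`, extended by zero to `t ≤ 0`,
serves as the `W^{1,2}`-representative of the extension of `u` on `K`.

* Multiplication by a nice cutoff function is bounded on `𝔻`, by the closed graph theorem
  (`IsNiceCutoff.continuous_mulₗ`). Together with regularity this extends strict locality to
  functions without compact support (`IsNiceCutoff.energy_eq_zero`).
* Testing the equation for `u` with `χ(t) ψ₁ g`, where `χ ∈ C_c^∞(0, T)` and `g ∈ 𝔻`, shows that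
  `ψ₁ u` has the weak derivative `g ↦ -E(ψ₃ u, ψ₁ g)` on `(0, T)`
  (`IsLocalWeakSolution.weakDeriv_cutoff`). This is in `L²((0, T); 𝔻*)` because
  `ψ₃ u ∈ L²((0, T); 𝔻)`.
* For each `g`, the scalar function `⟨ψ₁ u(t), g⟩` tends to zero at `0`, so extension by zero does
  not create a singular part of the derivative at `t = 0`: inserting a smooth step of width `ε` in
  front of the test function costs an error that vanishes with `ε` (`weakDeriv_extend_zero`).
* If `φ` is supported in `K`, then `ψ₁ φ = φ` and `E(ψ₁ u, φ) = E(ψ₃ u, φ)` by locality, so the two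
  integrands of the equation for the extension cancel at almost every time.
-/

namespace PosForm

variable {X : Type*} [MeasurableSpace X] {μ : Measure X} {E : PosForm μ}

/-! ### The form and the dual inclusion as bounded operators -/

theorem toL2_injective : Function.Injective E.toL2 :=
  Subtype.val_injective

variable (E) in
/-- The inclusion `f ↦ ⟨f, ·⟩_{L²}` of `𝔻` into `𝔻*`, as a bounded operator. -/
noncomputable def toDualL : E.Dom →L[ℝ] StrongDual ℝ E.Dom :=
  ((ContinuousLinearMap.compL ℝ E.Dom (Lp ℝ 2 μ) ℝ).flip E.toL2).comp
    ((innerSL ℝ).comp E.toL2)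

theorem toDualL_apply (f : E.Dom) : E.toDualL f = E.toDual f := rfl

theorem toDual_apply (f g : E.Dom) : E.toDual f g = inner ℝ (E.toL2 f) (E.toL2 g) := rfl

variable (E) in
/-- The form `E`, which is bounded for the norm of `E₁`, as an operator `𝔻 → 𝔻*`. -/
noncomputable def energyL : E.Dom →L[ℝ] StrongDual ℝ E.Dom :=
  (show E.Dom →L[ℝ] StrongDual ℝ E.Dom from innerSL ℝ) - E.toDualL

@[simp]
theorem energyL_apply (f g : E.Dom) : E.energyL f g = E.energy f g := by
  have h : E.energyL f g = inner ℝ f g - inner ℝ (E.inclₗ f) (E.inclₗ g) := rfl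
  rw [h, E.inner_def]
  ring

theorem energy_comm (f g : E.Dom) : E.energy f g = E.energy g f := E.symm f g

/-! ### Multiplication by a cutoff function -/

section Multiplication

variable [TopologicalSpace X]

/-- Multiplication by a nice cutoff function `ψ`, as a linear operator on `𝔻`. -/
noncomputable def IsNiceCutoff.mulₗ {ψ : X → ℝ} {K U : Set X} (h : E.IsNiceCutoff ψ K U) :
    E.Dom →ₗ[ℝ] E.Dom where
  toFun f := (h.mul_mem f).choose
  map_add' f g := by
    refine toL2_injective (Lp.ext ?_)
    have hadd := E.toL2.map_add (h.mul_mem f).choose (h.mul_mem g).choose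
    rw [hadd]
    filter_upwards [(h.mul_mem (f + g)).choose_spec, (h.mul_mem f).choose_spec,
      (h.mul_mem g).choose_spec, Lp.coeFn_add (E.toL2 (h.mul_mem f).choose)
        (E.toL2 (h.mul_mem g).choose), Lp.coeFn_add (E.toL2 f) (E.toL2 g)] with x h1 h2 h3 h4 h5
    rw [h1, E.toL2.map_add f g, h4, Pi.add_apply, h2, h3, h5, Pi.add_apply, mul_add]
  map_smul' c f := by
    refine toL2_injective (Lp.ext ?_)
    have hsmul := E.toL2.map_smul c (h.mul_mem f).choose
    rw [RingHom.id_apply, hsmul]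
    filter_upwards [(h.mul_mem (c • f)).choose_spec, (h.mul_mem f).choose_spec,
      Lp.coeFn_smul c (E.toL2 (h.mul_mem f).choose), Lp.coeFn_smul c (E.toL2 f)]
      with x h1 h2 h3 h4
    rw [h1, E.toL2.map_smul c f, h3, Pi.smul_apply, h2, h4, Pi.smul_apply, smul_eq_mul,
      smul_eq_mul, mul_left_comm]

theorem IsNiceCutoff.toL2_mulₗ {ψ : X → ℝ} {K U : Set X} (h : E.IsNiceCutoff ψ K U)
    (f : E.Dom) : E.toL2 (h.mulₗ f) =ᵐ[μ] fun x => ψ x * E.toL2 f x :=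
  (h.mul_mem f).choose_spec

theorem IsNiceCutoff.norm_toL2_mulₗ_le {ψ : X → ℝ} {K U : Set X} (h : E.IsNiceCutoff ψ K U)
    (f : E.Dom) : ‖E.toL2 (h.mulₗ f)‖ ≤ ‖E.toL2 f‖ := by
  refine Lp.norm_le_norm_of_ae_le ?_
  filter_upwards [h.toL2_mulₗ f] with x hx
  rw [hx, norm_mul, Real.norm_of_nonneg (h.mem_Icc x).1]
  exact mul_le_of_le_one_left (norm_nonneg _) (h.mem_Icc x).2

/-- Multiplication by a nice cutoff function is bounded on `𝔻`: it is bounded on `L²`, hence has a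
closed graph in `𝔻`. -/
theorem IsNiceCutoff.continuous_mulₗ [CompleteSpace E.Dom] {ψ : X → ℝ} {K U : Set X}
    (h : E.IsNiceCutoff ψ K U) : Continuous h.mulₗ := by
  refine LinearMap.continuous_of_seq_closed_graph _ fun u f g hu hg => toL2_injective ?_
  have h1 : Tendsto (fun n => E.toL2 (h.mulₗ (u n))) atTop (𝓝 (E.toL2 g)) :=
    (E.toL2.continuous.tendsto g).comp hg
  have h2 : Tendsto (fun n => E.toL2 (h.mulₗ (u n))) atTop (𝓝 (E.toL2 (h.mulₗ f))) := by
    rw [tendsto_iff_norm_sub_tendsto_zero]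
    have h3 : Tendsto (fun n => ‖E.toL2 (u n) - E.toL2 f‖) atTop (𝓝 0) :=
      tendsto_iff_norm_sub_tendsto_zero.mp ((E.toL2.continuous.tendsto f).comp hu)
    refine squeeze_zero (fun n => norm_nonneg _) (fun n => ?_) h3
    rw [← map_sub, ← map_sub, ← map_sub]
    exact h.norm_toL2_mulₗ_le _
  exact tendsto_nhds_unique h1 h2

/-- Multiplication by a nice cutoff function `ψ`, as a bounded operator on `𝔻`. -/
noncomputable def IsNiceCutoff.mulL [CompleteSpace E.Dom] {ψ : X → ℝ} {K U : Set X}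
    (h : E.IsNiceCutoff ψ K U) : E.Dom →L[ℝ] E.Dom :=
  ⟨h.mulₗ, h.continuous_mulₗ⟩

theorem IsNiceCutoff.toL2_mulL [CompleteSpace E.Dom] {ψ : X → ℝ} {K U : Set X}
    (h : E.IsNiceCutoff ψ K U) (f : E.Dom) :
    E.toL2 (h.mulL f) =ᵐ[μ] fun x => ψ x * E.toL2 f x :=
  h.toL2_mulₗ f

theorem IsNiceCutoff.isCompact_tsupport {ψ : X → ℝ} {K U : Set X} (h : E.IsNiceCutoff ψ K U) :
    IsCompact (tsupport ψ) :=
  h.compact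

theorem IsNiceCutoff.subset_tsupport {ψ : X → ℝ} {K U : Set X} (h : E.IsNiceCutoff ψ K U) :
    K ⊆ tsupport ψ := fun x hx =>
  _root_.subset_tsupport ψ (by rw [Function.mem_support, h.eq_one x hx]; exact one_ne_zero)

/-- Locality for a function `g` whose support need not be compact: if `f` is supported in a compact
set `C` and `g` is annihilated by a cutoff `η` that is `1` near `C`, then `E(f, g) = 0`. -/
theorem IsNiceCutoff.energy_eq_zero [CompleteSpace E.Dom] (hR : E.IsRegular)
    (hL : E.IsStrictlyLocal) {η : X → ℝ} {C C' U : Set X} (h : E.IsNiceCutoff η C' U)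
    (hC : IsCompact C) (hCC' : C ⊆ interior C') {f g : E.Dom}
    (hf : ∀ᵐ x ∂μ, x ∉ C → E.toL2 f x = 0) (hg : ∀ᵐ x ∂μ, η x * E.toL2 g x = 0) :
    E.energy f g = 0 := by
  -- `g = (1 - η) g` is the limit of the functions `(1 - η) k` with `k ∈ C_c(X) ∩ 𝔻`.
  have hg0 : h.mulL g = 0 := by
    refine toL2_injective (Lp.ext ?_)
    rw [map_zero]
    filter_upwards [h.toL2_mulL g, hg, Lp.coeFn_zero ℝ 2 μ] with x h1 h2 h3
    rw [h1, h2, h3, Pi.zero_apply]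
  have hclosed : IsClosed {k : E.Dom | E.energyL f (k - h.mulL k) = 0} :=
    isClosed_eq (by fun_prop) continuous_const
  have hsub : {k : E.Dom | ∃ g : X → ℝ, Continuous g ∧ HasCompactSupport g ∧
      E.toL2 k =ᵐ[μ] g} ⊆ {k : E.Dom | E.energyL f (k - h.mulL k) = 0} := by
    rintro k ⟨k', -, hk', hkk'⟩
    rw [mem_ofPred_eq, energyL_apply]
    have hsubk := Lp.coeFn_sub (E.toL2 k) (E.toL2 (h.mulL k))
    refine hL f _ C (tsupport k') (interior C') 0 hC hk' isOpen_interior hCC' hf ?_ ?_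
    · filter_upwards [hkk', hsubk, h.toL2_mulL k] with x h1 h2 h3 hx
      rw [map_sub, h2, Pi.sub_apply, h3, h1, image_eq_zero_of_notMem_tsupport hx]
      simp
    · filter_upwards [hsubk, h.toL2_mulL k] with x h2 h3 hx
      rw [map_sub, h2, Pi.sub_apply, h3, h.eq_one x (interior_subset hx)]
      simp
  have hmem := closure_minimal hsub hclosed (hR.dense_dom g)
  rwa [mem_ofPred_eq, hg0, sub_zero, energyL_apply] at hmem

end Multiplication

end PosForm

/-! ### Weak derivatives of functions on the line -/

/-- A smooth function that vanishes on `(-∞, ε]` and equals `1` on `[2ε, ∞)`. -/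
noncomputable def smoothStep (ε t : ℝ) : ℝ := Real.smoothTransition (ε⁻¹ * t - 1)

theorem contDiff_smoothStep (ε : ℝ) : ContDiff ℝ ∞ (smoothStep ε) :=
  Real.smoothTransition.contDiff.comp ((contDiff_const.mul contDiff_id).sub contDiff_const)

theorem smoothStep_eq_zero {ε t : ℝ} (hε : 0 < ε) (h : t ≤ ε) : smoothStep ε t = 0 := by
  refine Real.smoothTransition.zero_of_nonpos ?_
  have : ε⁻¹ * t ≤ ε⁻¹ * ε := by gcongr
  rw [inv_mul_cancel₀ hε.ne'] at this
  linarith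

theorem smoothStep_eq_one {ε t : ℝ} (hε : 0 < ε) (h : 2 * ε ≤ t) : smoothStep ε t = 1 := by
  refine Real.smoothTransition.one_of_one_le ?_
  have : ε⁻¹ * (2 * ε) ≤ ε⁻¹ * t := by gcongr
  rw [mul_left_comm, inv_mul_cancel₀ hε.ne'] at this
  linarith

theorem norm_smoothStep_le (ε t : ℝ) : ‖smoothStep ε t‖ ≤ 1 := by
  rw [smoothStep, Real.norm_of_nonneg (Real.smoothTransition.nonneg _)]
  exact Real.smoothTransition.le_one _

theorem deriv_smoothStep (ε t : ℝ) :
    deriv (smoothStep ε) t = ε⁻¹ * deriv Real.smoothTransition (ε⁻¹ * t - 1) := by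
  have h1 : HasDerivAt (fun t : ℝ => ε⁻¹ * t - 1) ε⁻¹ t := by
    simpa using ((hasDerivAt_id t).const_mul ε⁻¹).sub_const 1
  have h2 : HasDerivAt Real.smoothTransition _ (ε⁻¹ * t - 1) :=
    ((Real.smoothTransition.contDiff (n := 1)).differentiable (by simp) _).hasDerivAt
  rw [mul_comm]
  exact (h2.comp t h1).deriv

theorem deriv_smoothStep_eq_zero {ε t : ℝ} (hε : 0 < ε) (h : 2 * ε < t) :
    deriv (smoothStep ε) t = 0 := by
  have : smoothStep ε =ᶠ[𝓝 t] fun _ => 1 := by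
    filter_upwards [lt_mem_nhds h] with s hs using smoothStep_eq_one hε hs.le
  rw [this.deriv_eq, deriv_const]

theorem exists_bound_deriv_smoothTransition :
    ∃ C : ℝ, ∀ t, ‖deriv Real.smoothTransition t‖ ≤ C := by
  have hcont : Continuous (deriv Real.smoothTransition) :=
    (Real.smoothTransition.contDiff (n := 1)).continuous_deriv (by simp)
  obtain ⟨C, hC⟩ := (isCompact_Icc (a := (0 : ℝ)) (b := 1)).exists_bound_of_continuousOn
    hcont.continuousOn
  refine ⟨C, fun t => ?_⟩
  have hC0 : 0 ≤ C := (norm_nonneg _).trans (hC 0 (by simp))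
  by_cases ht : t ∈ Icc (0 : ℝ) 1
  · exact hC t ht
  · suffices deriv Real.smoothTransition t = 0 by simpa [this] using hC0
    rcases not_and_or.mp ht with h | h
    · have : Real.smoothTransition =ᶠ[𝓝 t] fun _ => 0 := by
        filter_upwards [gt_mem_nhds (not_le.mp h)] with s hs
          using Real.smoothTransition.zero_of_nonpos hs.le
      rw [this.deriv_eq, deriv_const]
    · have : Real.smoothTransition =ᶠ[𝓝 t] fun _ => 1 := by
        filter_upwards [lt_mem_nhds (not_le.mp h)] with s hs
          using Real.smoothTransition.one_of_one_le hs.le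
      rw [this.deriv_eq, deriv_const]

/-- Multiplying by the derivative of a smooth step, which is `O(1/ε)` and supported in `(0, 2ε]`,
gives a vanishing contribution when the essential limit at `0` is zero. -/
theorem tendsto_integral_deriv_smoothStep {T : ℝ} {a : ℝ → ℝ}
    (ha0 : Tendsto a (𝓝[>] 0 ⊓ ae volume) (𝓝 0)) :
    Tendsto (fun ε => ∫ t in Ioo 0 T, deriv (smoothStep ε) t * a t) (𝓝[>] 0) (𝓝 0) := by
  obtain ⟨C, hC⟩ := exists_bound_deriv_smoothTransition
  have hC0 : 0 ≤ C := (norm_nonneg _).trans (hC 0)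
  rw [Metric.tendsto_nhds]
  intro r hr
  set r' := r / (2 * C + 1) with hr'
  have hr'0 : 0 < r' := by positivity
  have hev := Metric.tendsto_nhds.mp ha0 r' hr'0
  obtain ⟨s, hs, t, ht, hst⟩ := eventually_inf.mp hev
  obtain ⟨δ, hδ, hδs⟩ := (mem_nhdsGT_iff_exists_Ioo_subset).mp hs
  have hδ0 : (0 : ℝ) < δ := hδ
  filter_upwards [Ioo_mem_nhdsGT (half_pos hδ0)] with ε hε
  rw [dist_zero_right]
  have hε0 : 0 < ε := hε.1
  have hpt : ∀ᵐ t ∂(volume.restrict (Ioo 0 T)), ‖deriv (smoothStep ε) t * a t‖ ≤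
      (Ioc 0 (2 * ε)).indicator (fun _ => ε⁻¹ * C * r') t := by
    filter_upwards [ae_restrict_mem measurableSet_Ioo, ae_restrict_of_ae ht] with τ hτ hτt
    by_cases hle : τ ≤ 2 * ε
    · rw [indicator_of_mem (show τ ∈ Ioc 0 (2 * ε) from ⟨hτ.1, hle⟩), norm_mul,
        deriv_smoothStep, norm_mul, Real.norm_of_nonneg (inv_nonneg.mpr hε0.le)]
      have h1 : ‖a τ‖ ≤ r' := by
        have := hst τ ⟨hδs ⟨hτ.1, by linarith [hε.2]⟩, hτt⟩
        rw [dist_zero_right] at this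
        exact this.le
      gcongr
      exact hC _
    · rw [deriv_smoothStep_eq_zero hε0 (not_le.mp hle), zero_mul, norm_zero,
        indicator_of_notMem fun h => hle h.2]
  have hint : Integrable ((Ioc 0 (2 * ε)).indicator (fun _ => ε⁻¹ * C * r')) volume :=
    (integrable_indicator_iff measurableSet_Ioc).mpr (integrableOn_const measure_Ioc_lt_top.ne)
  calc ‖∫ t in Ioo 0 T, deriv (smoothStep ε) t * a t‖
      ≤ ∫ t in Ioo 0 T, (Ioc 0 (2 * ε)).indicator (fun _ => ε⁻¹ * C * r') t :=
        norm_integral_le_of_norm_le hint.restrict hpt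
    _ ≤ ∫ t, (Ioc 0 (2 * ε)).indicator (fun _ => ε⁻¹ * C * r') t :=
        setIntegral_le_integral hint (Eventually.of_forall fun t =>
          indicator_nonneg (fun _ _ => by positivity) t)
    _ = 2 * C * r' := by
        rw [integral_indicator measurableSet_Ioc, setIntegral_const, Measure.real,
          Real.volume_Ioc, sub_zero, ENNReal.toReal_ofReal (by linarith), smul_eq_mul]
        field_simp
    _ < (2 * C + 1) * r' := by linarith
    _ = r := by rw [hr']; field_simp

theorem tendsto_integral_smoothStep_mul {T : ℝ} {b : ℝ → ℝ} (hb : IntegrableOn b (Ioo 0 T)) :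
    Tendsto (fun ε => ∫ t in Ioo 0 T, smoothStep ε t * b t) (𝓝[>] 0)
      (𝓝 (∫ t in Ioo 0 T, b t)) := by
  refine tendsto_integral_filter_of_dominated_convergence (fun t => ‖b t‖) ?_ ?_ hb.norm ?_
  · exact Eventually.of_forall fun ε =>
      (contDiff_smoothStep ε).continuous.aestronglyMeasurable.mul hb.aestronglyMeasurable
  · refine Eventually.of_forall fun ε => Eventually.of_forall fun t => ?_
    rw [norm_mul]
    exact mul_le_of_le_one_left (norm_nonneg _) (norm_smoothStep_le ε t)
  · filter_upwards [ae_restrict_mem measurableSet_Ioo] with t ht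
    refine tendsto_const_nhds.congr' ?_
    filter_upwards [Ioo_mem_nhdsGT (half_pos ht.1)] with ε hε
    rw [smoothStep_eq_one hε.1 (by linarith [hε.2]), one_mul]

/-- If `b` is the weak derivative of `a` on `(0, T)` and `a` tends to zero at `0`, then the
extensions of `a` and `b` by zero are in the same relation on `(-∞, T)`. -/
theorem weakDeriv_extend_zero {T : ℝ} {a b : ℝ → ℝ} (ha : IntegrableOn a (Ioo 0 T))
    (hb : IntegrableOn b (Ioo 0 T)) (ha0 : Tendsto a (𝓝[>] 0 ⊓ ae volume) (𝓝 0))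
    (hab : ∀ χ : ℝ → ℝ, ContDiff ℝ ∞ χ → HasCompactSupport χ → tsupport χ ⊆ Ioo 0 T →
      ∫ t in Ioo 0 T, χ t * b t = - ∫ t in Ioo 0 T, deriv χ t * a t)
    {χ : ℝ → ℝ} (hχ : ContDiff ℝ ∞ χ) (hχc : HasCompactSupport χ) (hχT : tsupport χ ⊆ Iio T) :
    ∫ t in Ioo 0 T, χ t * b t = - ∫ t in Ioo 0 T, deriv χ t * a t := by
  have hχ' : Continuous (deriv χ) := hχ.continuous_deriv (by simp)
  obtain ⟨M, hM⟩ := hχ.continuous.bounded_above_of_compact_support hχc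
  obtain ⟨M', hM'⟩ := hχ'.bounded_above_of_compact_support hχc.deriv
  have hχb : IntegrableOn (fun t => χ t * b t) (Ioo 0 T) :=
    hb.bdd_mul hχ.continuous.aestronglyMeasurable (Eventually.of_forall hM)
  have hχa : IntegrableOn (fun t => deriv χ t * a t) (Ioo 0 T) :=
    ha.bdd_mul hχ'.aestronglyMeasurable (Eventually.of_forall hM')
  have hlim0 : Tendsto (fun t => χ t * a t) (𝓝[>] 0 ⊓ ae volume) (𝓝 0) := by
    refine squeeze_zero_norm (a := fun t => M * ‖a t‖) (fun t => ?_) ?_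
    · rw [norm_mul]
      gcongr
      exact hM t
    · simpa using ha0.norm.const_mul M
  have h1 := tendsto_integral_smoothStep_mul hχb
  have h2 := tendsto_integral_smoothStep_mul hχa
  have h3 := tendsto_integral_deriv_smoothStep (T := T) hlim0
  have h4 : Tendsto (fun ε => ∫ t in Ioo 0 T, smoothStep ε t * (χ t * b t)) (𝓝[>] 0)
      (𝓝 (-(0 + ∫ t in Ioo 0 T, deriv χ t * a t))) := by
    refine (h3.add h2).neg.congr' ?_
    filter_upwards [self_mem_nhdsWithin] with ε (hε : 0 < ε)
    have hη := contDiff_smoothStep ε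
    have hη' : Continuous (deriv (smoothStep ε)) := hη.continuous_deriv (by simp)
    have hsupp : tsupport (smoothStep ε * χ) ⊆ Ioo 0 T := fun t ht => by
      refine ⟨?_, hχT (tsupport_mul_subset_right ht)⟩
      have hsub : tsupport (smoothStep ε) ⊆ Ici ε :=
        closure_minimal (fun s hs => le_of_not_ge fun h => hs (smoothStep_eq_zero hε h)) isClosed_Ici
      exact hε.trans_le (hsub (tsupport_mul_subset_left ht))
    have hη'b : ∃ B, ∀ t, ‖deriv (smoothStep ε) t‖ ≤ B := by
      obtain ⟨C, hC⟩ := exists_bound_deriv_smoothTransition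
      refine ⟨ε⁻¹ * C, fun t => ?_⟩
      rw [deriv_smoothStep, norm_mul, Real.norm_of_nonneg (inv_nonneg.mpr hε.le)]
      gcongr
      exact hC _
    obtain ⟨B, hB⟩ := hη'b
    have hi1 : IntegrableOn (fun t => deriv (smoothStep ε) t * (χ t * a t)) (Ioo 0 T) :=
      (ha.bdd_mul hχ.continuous.aestronglyMeasurable (Eventually.of_forall hM)).bdd_mul
        hη'.aestronglyMeasurable (Eventually.of_forall hB)
    have hi2 : IntegrableOn (fun t => smoothStep ε t * (deriv χ t * a t)) (Ioo 0 T) :=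
      hχa.bdd_mul hη.continuous.aestronglyMeasurable
        (Eventually.of_forall (norm_smoothStep_le ε))
    have key := hab (smoothStep ε * χ) (hη.mul hχ) hχc.mul_left hsupp
    simp only [Pi.mul_apply, mul_assoc] at key
    rw [← integral_add hi1 hi2, key]
    congr 1
    refine integral_congr_ae (Eventually.of_forall fun t => ?_)
    have hd : deriv (smoothStep ε * χ) t =
        deriv (smoothStep ε) t * χ t + smoothStep ε t * deriv χ t :=
      deriv_mul (hη.differentiable (by simp) t) (hχ.differentiable (by simp) t)
    simp only [hd]
    ring
  rw [zero_add] at h4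
  exact tendsto_nhds_unique h1 h4

/-! ### Curves in the form domain -/

theorem integrable_smul_of_memLp_two {G : Type*} [NormedAddCommGroup G] [NormedSpace ℝ G]
    {ν : Measure ℝ} [IsFiniteMeasureOnCompacts ν] {χ : ℝ → ℝ} {f : ℝ → G} (hχ : Continuous χ)
    (hχc : HasCompactSupport χ) (hf : MemLp f 2 ν) : Integrable (fun t => χ t • f t) ν :=
  memLp_one_iff_integrable.mp (hf.smul (hχ.memLp_of_hasCompactSupport (p := 2) hχc))

theorem memLp_two_extend_zero {G : Type*} [NormedAddCommGroup G] {T : ℝ} {v : ℝ → G}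
    (h : MemLp v 2 (volume.restrict (Ioo 0 T))) :
    MemLp ((Ioi 0).indicator v) 2 (volume.restrict (Iio T)) := by
  rwa [memLp_indicator_iff_restrict measurableSet_Ioi,
    Measure.restrict_restrict measurableSet_Ioi, Ioi_inter_Iio]

namespace PosForm

variable {X : Type*} [MeasurableSpace X] {μ : Measure X} {E : PosForm μ}

/-- A relation of curves on `I × X`, read off on almost every time slice. -/
theorem AEEqOn.ae_slice [SFinite μ] {I : Set ℝ} {u : ℝ → X → ℝ} {v : ℝ → E.Dom}
    {S : Set (ℝ × X)} (h : E.AEEqOn I u v S) :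
    ∀ᵐ t ∂(volume.restrict I), ∀ᵐ x ∂μ, (t, x) ∈ S → u t x = E.toL2 (v t) x := by
  obtain ⟨w, ⟨-, hw⟩, hu⟩ := h
  filter_upwards [hw, Measure.ae_ae_of_ae_prod hu] with t h1 h2
  filter_upwards [h1, h2] with x h3 h4 hx
  rw [h4 hx, ← h3]

/-- Extension of a curve and of the function it represents by zero to negative times. -/
theorem AEEqOn.extend_zero [SFinite μ] {T : ℝ} {u : ℝ → X → ℝ} {v : ℝ → E.Dom}
    {S : Set (ℝ × X)} (h : E.AEEqOn (Ioo 0 T) u v S) :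
    E.AEEqOn (Iio T) (fun t x => if t ≤ 0 then 0 else u t x) ((Ioi 0).indicator v) S := by
  obtain ⟨w, ⟨hwm, hw⟩, hu⟩ := h
  have hI : Ioi (0 : ℝ) ∩ Iio T = Ioo 0 T := Ioi_inter_Iio
  have hms : MeasurableSet (Ioi (0 : ℝ) ×ˢ (univ : Set X)) := measurableSet_Ioi.prod .univ
  have hrestr : ((volume.restrict (Iio T)).prod μ).restrict (Ioi (0 : ℝ) ×ˢ (univ : Set X)) =
      (volume.restrict (Ioo 0 T)).prod μ := by
    rw [← Measure.prod_restrict, Measure.restrict_univ, Measure.restrict_restrict measurableSet_Ioi,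
      hI]
  refine ⟨(Ioi (0 : ℝ) ×ˢ (univ : Set X)).indicator w, ⟨?_, ?_⟩, ?_⟩
  · rw [aestronglyMeasurable_indicator_iff hms, hrestr]
    exact hwm
  · rw [← hI, ← Measure.restrict_restrict measurableSet_Ioi,
      ae_restrict_iff' measurableSet_Ioi] at hw
    filter_upwards [hw] with t ht
    by_cases h0 : t ∈ Ioi (0 : ℝ)
    · rw [indicator_of_mem h0]
      filter_upwards [ht h0] with x hx
      rw [indicator_of_mem (show (t, x) ∈ Ioi (0 : ℝ) ×ˢ univ from ⟨h0, mem_univ x⟩), hx]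
    · rw [indicator_of_notMem h0, map_zero]
      filter_upwards [Lp.coeFn_zero ℝ 2 μ] with x hx
      rw [indicator_of_notMem (fun h => h0 h.1), hx, Pi.zero_apply]
  · rw [← hrestr, ae_restrict_iff' hms] at hu
    filter_upwards [hu] with p hp hpS
    by_cases h0 : p.1 ≤ 0
    · rw [if_pos h0, indicator_of_notMem (fun h => not_lt.mpr h0 h.1)]
    · have hp0 : p ∈ Ioi (0 : ℝ) ×ˢ (univ : Set X) := ⟨not_le.mp h0, mem_univ _⟩
      rw [if_neg h0, indicator_of_mem hp0, hp hp0 hpS]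

theorem memW12_smul_const {I : Set ℝ} {χ : ℝ → ℝ} (hχ : ContDiff ℝ ∞ χ)
    (hχc : HasCompactSupport χ) (g : E.Dom) :
    E.MemW12 I (fun t => χ t • g) (fun t => deriv χ t • E.toDual g) where
  memL2 := (hχ.continuous.smul continuous_const).memLp_of_hasCompactSupport hχc.smul_right
  memL2_deriv := ((hχ.continuous_deriv (by simp)).smul
    continuous_const).memLp_of_hasCompactSupport hχc.deriv.smul_right
  weak_deriv η hη hηc hηI := by
    have hη' : Continuous (deriv η) := hη.continuous_deriv (by simp)
    have hχ' : Continuous (deriv χ) := hχ.continuous_deriv (by simp)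
    have hint {a b : ℝ → ℝ} (ha : Continuous a) (hb : Continuous b) (hac : HasCompactSupport a) :
        Integrable (a * b) volume :=
      (ha.mul hb).integrable_of_hasCompactSupport hac.mul_right
    have hparts : ∫ t, η t * deriv χ t = - ∫ t, deriv η t * χ t :=
      integral_mul_deriv_eq_deriv_mul_of_integrable
        (fun t _ => (hη.differentiable (by simp) t).hasDerivAt)
        (fun t _ => (hχ.differentiable (by simp) t).hasDerivAt)
        (hint hη.continuous hχ' hηc) (hint hη' hχ.continuous hηc.deriv)
        (hint hη.continuous hχ.continuous hηc)
    have h1 : ∫ t in I, η t * deriv χ t = ∫ t, η t * deriv χ t :=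
      setIntegral_eq_integral_of_forall_compl_eq_zero fun t ht => by
        rw [image_eq_zero_of_notMem_tsupport fun h => ht (hηI h), zero_mul]
    have h2 : ∫ t in I, deriv η t * χ t = ∫ t, deriv η t * χ t :=
      setIntegral_eq_integral_of_forall_compl_eq_zero fun t ht => by
        rw [image_eq_zero_of_notMem_tsupport fun h => ht (hηI (tsupport_deriv_subset h)), zero_mul]
    have hsm (c : ℝ) : E.toDual (c • g) = c • E.toDual g := E.toDualL.map_smul c g
    simp_rw [hsm, smul_smul]
    rw [integral_smul_const, integral_smul_const, h1, h2, hparts, neg_smul]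

/-- The weak time derivative, tested against an element of `𝔻`. -/
theorem MemW12.weak_deriv_apply {I : Set ℝ} {v : ℝ → E.Dom} {v' : ℝ → StrongDual ℝ E.Dom}
    (h : E.MemW12 I v v') {χ : ℝ → ℝ} (hχ : ContDiff ℝ ∞ χ) (hχc : HasCompactSupport χ)
    (hχI : tsupport χ ⊆ I) (g : E.Dom) :
    ∫ t in I, χ t * v' t g = - ∫ t in I, deriv χ t * E.toDual (v t) g := by
  have hdual : MemLp (fun t => E.toDual (v t)) 2 (volume.restrict I) :=
    E.toDualL.comp_memLp' h.memL2
  have h1 := ContinuousLinearMap.integral_apply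
    (integrable_smul_of_memLp_two hχ.continuous hχc h.memL2_deriv) g
  have h2 := ContinuousLinearMap.integral_apply
    (integrable_smul_of_memLp_two (hχ.continuous_deriv (by simp)) hχc.deriv hdual) g
  have h3 := congrArg (fun F : StrongDual ℝ E.Dom => F g) (h.weak_deriv χ hχ hχc hχI)
  simp only [neg_apply] at h3
  rw [h1, h2] at h3
  exact h3

section Multiplication

variable [TopologicalSpace X] [CompleteSpace E.Dom]

theorem IsNiceCutoff.toDual_mulL {ψ : X → ℝ} {K U : Set X} (h : E.IsNiceCutoff ψ K U)
    {a b : E.Dom} (hab : ∀ᵐ x ∂μ, ψ x * E.toL2 a x = E.toL2 b x) (g : E.Dom) :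
    E.toDual a (h.mulL g) = E.toDual b g := by
  rw [toDual_apply, toDual_apply, L2.inner_def, L2.inner_def]
  refine integral_congr_ae ?_
  filter_upwards [hab, h.toL2_mulL g] with x h1 h2
  simp only [h2, ← h1, RCLike.inner_apply, conj_trivial]
  ring

/-- The curve `t ↦ χ(t) ψ g` is a test function supported in `supp χ × supp ψ`. -/
theorem IsNiceCutoff.aeEqOn_smul_mulL [SFinite μ] {ψ : X → ℝ} {K U : Set X}
    (h : E.IsNiceCutoff ψ K U) {I : Set ℝ} {χ : ℝ → ℝ} (hχ : Continuous χ) (g : E.Dom)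
    {S : Set X} (hS : tsupport ψ ⊆ S) :
    E.AEEqOn I 0 (fun t => χ t • h.mulL g) (tsupport χ ×ˢ S)ᶜ := by
  refine ⟨fun p => χ p.1 * E.toL2 (h.mulL g) p.2, ⟨?_, ?_⟩, ?_⟩
  · exact (hχ.measurable.comp measurable_fst).aestronglyMeasurable.mul
      (Lp.aestronglyMeasurable (E.toL2 (h.mulL g))).comp_snd
  · refine Eventually.of_forall fun t => ?_
    rw [map_smul]
    filter_upwards [Lp.coeFn_smul (χ t) (E.toL2 (h.mulL g))] with x hx
    rw [hx, Pi.smul_apply, smul_eq_mul]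
  · filter_upwards [Measure.quasiMeasurePreserving_snd.ae (h.toL2_mulL g)] with p hp hpS
    rw [hp, Pi.zero_apply, Pi.zero_apply]
    by_cases h1 : p.1 ∈ tsupport χ
    · have h2 : p.2 ∉ tsupport ψ := fun h2 => hpS ⟨h1, hS h2⟩
      rw [image_eq_zero_of_notMem_tsupport h2, zero_mul, mul_zero]
    · rw [image_eq_zero_of_notMem_tsupport h1, zero_mul]

/-! ### Localised local weak solutions -/

/-- If `ψ₁ ≺ ψ₂ ≺ ψ₃` are nested nice cutoff functions, the weak time derivative of `ψ₁ u` is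
`g ↦ -E(ψ₃ u, ψ₁ g)`: by locality `ψ₃ u` may replace the `W^{1,2}`-representative of `u`, which
depends on the test function. -/
theorem IsLocalWeakSolution.weakDeriv_cutoff [SFinite μ] (hR : E.IsRegular)
    (hL : E.IsStrictlyLocal) {I : Set ℝ} {U : Set X} {u : ℝ → X → ℝ}
    (hu : E.IsLocalWeakSolution I U u) {ψ₁ ψ₂ ψ₃ : X → ℝ} {K₁ K₂ : Set X}
    (h₁ : E.IsNiceCutoff ψ₁ K₁ U) (h₂ : E.IsNiceCutoff ψ₂ K₂ U)
    (h₃ : E.IsNiceCutoff ψ₃ (tsupport ψ₂) U) (h₁₂ : tsupport ψ₁ ⊆ interior K₂)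
    {v₁ v₃ : ℝ → E.Dom} (hv₁ : E.AEEqOn I (fun t x => ψ₁ x * u t x) v₁ univ)
    (hv₃ : E.AEEqOn I (fun t x => ψ₃ x * u t x) v₃ univ)
    {χ : ℝ → ℝ} (hχ : ContDiff ℝ ∞ χ) (hχc : HasCompactSupport χ) (hχI : tsupport χ ⊆ I)
    (g : E.Dom) :
    ∫ t in I, χ t * -E.energy (v₃ t) (h₁.mulL g) =
      - ∫ t in I, deriv χ t * E.toDual (v₁ t) g := by
  have hψ₁₂ : tsupport ψ₁ ⊆ tsupport ψ₂ :=
    h₁₂.trans (interior_subset.trans h₂.subset_tsupport)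
  obtain ⟨v, v', hv, hveq, htest⟩ := hu (tsupport χ ×ˢ tsupport ψ₂)
    (hχc.isCompact.prod h₂.isCompact_tsupport) (prod_mono hχI h₂.support_subset)
  have heq := htest _ _ (memW12_smul_const hχ hχc (h₁.mulL g))
    (h₁.aeEqOn_smul_mulL hχ.continuous g hψ₁₂)
  have hderiv := hv.weak_deriv_apply hχ hχc hχI (h₁.mulL g)
  have hsv := hveq.ae_slice
  have hsv₁ := hv₁.ae_slice
  have hsv₃ := hv₃.ae_slice
  have hD : ∫ t in I, deriv χ t * E.toDual (v t) (h₁.mulL g) =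
      ∫ t in I, deriv χ t * E.toDual (v₁ t) g := by
    refine integral_congr_ae ?_
    filter_upwards [hsv, hsv₁] with t ht ht₁
    by_cases hχt : t ∈ tsupport χ
    · congr 1
      refine h₁.toDual_mulL ?_ g
      filter_upwards [ht, ht₁] with x hx hx₁
      rw [← hx₁ (mem_univ _)]
      by_cases hxψ : x ∈ tsupport ψ₁
      · rw [hx ⟨hχt, hψ₁₂ hxψ⟩]
      · rw [image_eq_zero_of_notMem_tsupport hxψ, zero_mul, zero_mul]
    · simp only [image_eq_zero_of_notMem_tsupport fun h => hχt (tsupport_deriv_subset h),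
        zero_mul]
  have hE : ∫ t in I, E.energy (v t) (χ t • h₁.mulL g) =
      ∫ t in I, χ t * E.energy (v₃ t) (h₁.mulL g) := by
    refine integral_congr_ae ?_
    filter_upwards [hsv, hsv₃] with t ht ht₃
    have hsmul : E.energy (v t) (χ t • h₁.mulL g) = χ t * E.energy (v t) (h₁.mulL g) := by
      rw [← energyL_apply, map_smul, energyL_apply, smul_eq_mul]
    rw [hsmul]
    by_cases hχt : t ∈ tsupport χ
    · have hzero : E.energy (h₁.mulL g) (v t - v₃ t) = 0 := by
        refine h₂.energy_eq_zero hR hL h₁.isCompact_tsupport h₁₂ ?_ ?_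
        · filter_upwards [h₁.toL2_mulL g] with x hx hxψ
          rw [hx, image_eq_zero_of_notMem_tsupport hxψ, zero_mul]
        · rw [map_sub]
          filter_upwards [ht, ht₃, Lp.coeFn_sub (E.toL2 (v t)) (E.toL2 (v₃ t))] with x hx hx₃ hs
          rw [hs, Pi.sub_apply, ← hx₃ (mem_univ _)]
          by_cases hxψ : x ∈ tsupport ψ₂
          · rw [← hx ⟨hχt, hxψ⟩, h₃.eq_one x hxψ, one_mul, sub_self, mul_zero]
          · rw [image_eq_zero_of_notMem_tsupport hxψ, zero_mul]
      rw [← energyL_apply, map_sub, energyL_apply, energyL_apply, energy_comm _ (v t),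
        energy_comm _ (v₃ t), sub_eq_zero] at hzero
      rw [hzero]
    · rw [image_eq_zero_of_notMem_tsupport hχt, zero_mul, zero_mul]
  rw [hE] at heq
  simp only [map_smul, smul_eq_mul] at heq
  simp only [mul_neg]
  rw [integral_neg, ← hD, ← hderiv]
  linarith

end Multiplication

end PosForm

/-! ### The extension principle -/

theorem lemma5p2 {X : Type*} [MetricSpace X] [SecondCountableTopology X] [LocallyCompactSpace X]
    [MeasurableSpace X] [BorelSpace X]
    (μ : Measure X) [IsLocallyFiniteMeasure μ] [μ.IsOpenPosMeasure]
    (E : PosForm μ) (hD : E.IsDirichletForm) (hR : E.IsRegular) (hL : E.IsStrictlyLocal)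
    (T : ℝ) (hT : 0 < T) (U : Set X) (hU : IsOpen U) (hUnice : E.IsNice U)
    (u : ℝ → X → ℝ) (hu : E.IsLocalWeakSolution (Ioo 0 T) U u)
    (hψL2 : ∀ (K : Set X) (ψ : X → ℝ), IsCompact K → K ⊆ U → E.IsNiceCutoff ψ K U →
      ∃ v : ℝ → E.Dom, E.MemL2 (Ioo 0 T) v ∧
        E.AEEqOn (Ioo 0 T) (fun t x => ψ x * u t x) v univ)
    (hψ0 : ∀ (K : Set X) (ψ : X → ℝ), IsCompact K → K ⊆ U → E.IsNiceCutoff ψ K U →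
      WeaklyTendsToZero μ (fun t x => ψ x * u t x)) :
    E.IsLocalWeakSolution (Iio T) U (fun t x => if t ≤ 0 then 0 else u t x) := by
  have : CompleteSpace E.Dom := hD.closed
  intro K hK hKU
  -- Nested cutoffs `ψ₀ ≺ ψ₁ ≺ ψ₂ ≺ ψ₃` with `ψ₀ = 1` near the projection `K'` of `K` to `X`.
  set K' : Set X := Prod.snd '' K with hK'
  have hK'c : IsCompact K' := hK.image continuous_snd
  have hK'U : K' ⊆ U := by
    rintro x ⟨p, hp, rfl⟩
    exact (hKU hp).2
  obtain ⟨C₀, hC₀, hK'C₀, hC₀U⟩ := exists_compact_between hK'c hU hK'U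
  obtain ⟨ψ₀, h₀⟩ := hUnice C₀ hC₀ hC₀U
  obtain ⟨ψ₁, h₁⟩ := hUnice _ h₀.isCompact_tsupport h₀.support_subset
  obtain ⟨C₂, hC₂, h₁C₂, hC₂U⟩ :=
    exists_compact_between h₁.isCompact_tsupport hU h₁.support_subset
  obtain ⟨ψ₂, h₂⟩ := hUnice C₂ hC₂ hC₂U
  obtain ⟨ψ₃, h₃⟩ := hUnice _ h₂.isCompact_tsupport h₂.support_subset
  have hsub₁₂ : tsupport ψ₁ ⊆ tsupport ψ₂ :=
    h₁C₂.trans (interior_subset.trans h₂.subset_tsupport)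
  have hone : ∀ x ∈ K', ψ₁ x = 1 := fun x hx =>
    h₁.eq_one x (h₀.subset_tsupport (interior_subset (hK'C₀ hx)))
  obtain ⟨v₁, hv₁, hv₁u⟩ := hψL2 _ ψ₁ h₀.isCompact_tsupport h₀.support_subset h₁
  obtain ⟨v₃, hv₃, hv₃u⟩ := hψL2 _ ψ₃ h₂.isCompact_tsupport h₂.support_subset h₃
  -- The weak derivative of `ψ₁ u` is `F(t) = -E(ψ₃ u(t), ψ₁ ·)`.
  set F : ℝ → StrongDual ℝ E.Dom := fun t => -(E.energyL (v₃ t)).comp h₁.mulL with hF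
  have hFapply (t : ℝ) (g : E.Dom) : F t g = -E.energy (v₃ t) (h₁.mulL g) := by
    simp [hF]
  have hFmem : MemLp F 2 (volume.restrict (Ioo 0 T)) := by
    have := ((((ContinuousLinearMap.compL ℝ E.Dom E.Dom ℝ).flip h₁.mulL).comp
      E.energyL).comp_memLp' hv₃).neg
    exact this
  have hdual : MemLp (fun t => E.toDual (v₁ t)) 2 (volume.restrict (Ioo 0 T)) :=
    E.toDualL.comp_memLp' hv₁
  have hI : Iio T ∩ Ioi 0 = Ioo 0 T := by rw [inter_comm, Ioi_inter_Iio]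
  refine ⟨(Ioi 0).indicator v₁, (Ioi 0).indicator F, ⟨memLp_two_extend_zero hv₁,
    memLp_two_extend_zero hFmem, ?_⟩, ?_, ?_⟩
  · intro χ hχ hχc hχT
    have e1 : ∫ t in Iio T, χ t • (Ioi (0 : ℝ)).indicator F t = ∫ t in Ioo 0 T, χ t • F t := by
      simp_rw [← indicator_smul_apply (Ioi (0 : ℝ)) χ F]
      rw [setIntegral_indicator measurableSet_Ioi, hI]
    have e2 : ∫ t in Iio T, deriv χ t • E.toDual ((Ioi (0 : ℝ)).indicator v₁ t) =
        ∫ t in Ioo 0 T, deriv χ t • E.toDual (v₁ t) := by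
      rw [← hI, ← setIntegral_indicator measurableSet_Ioi]
      congr 1
      funext t
      by_cases ht : t ∈ Ioi (0 : ℝ)
      · rw [indicator_of_mem ht, indicator_of_mem ht]
      · rw [indicator_of_notMem ht, indicator_of_notMem ht, ← PosForm.toDualL_apply, map_zero,
          smul_zero]
    rw [e1, e2]
    have hχ' : Continuous (deriv χ) := hχ.continuous_deriv (by simp)
    ext g
    rw [neg_apply, ContinuousLinearMap.integral_apply
      (integrable_smul_of_memLp_two hχ.continuous hχc hFmem) g,
      ContinuousLinearMap.integral_apply
      (integrable_smul_of_memLp_two hχ' hχc.deriv hdual) g]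
    simp only [smul_apply, smul_eq_mul]
    have ha0 : Tendsto (fun t => E.toDual (v₁ t) g) (𝓝[>] 0 ⊓ ae volume) (𝓝 0) := by
      refine (hψ0 _ ψ₁ h₀.isCompact_tsupport h₀.support_subset h₁ (E.toL2 g)).congr' ?_
      have hae := hv₁u.ae_slice
      rw [ae_restrict_iff' measurableSet_Ioo] at hae
      refine eventually_inf.mpr ⟨Ioo 0 T, Ioo_mem_nhdsGT hT, _, hae, fun t ht => ?_⟩
      dsimp only
      rw [PosForm.toDual_apply, L2.inner_def]
      refine integral_congr_ae ?_
      filter_upwards [ht.2 ht.1] with x hx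
      simp only [← hx (mem_univ _), RCLike.inner_apply, conj_trivial, mul_comm]
    refine weakDeriv_extend_zero ?_ ?_ ha0 ?_ hχ hχc hχT
    · exact ((ContinuousLinearMap.apply ℝ ℝ g).comp_memLp' hdual).integrable one_le_two
    · exact ((ContinuousLinearMap.apply ℝ ℝ g).comp_memLp' hFmem).integrable one_le_two
    · intro η hη hηc hηT
      simp only [hFapply]
      exact hu.weakDeriv_cutoff hR hL h₁ h₂ h₃ h₁C₂ hv₁u hv₃u hη hηc hηT g
  · -- `u = ψ₁ u` on `K`.
    obtain ⟨w, hw, hwu⟩ := hv₁u.extend_zero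
    refine ⟨w, hw, ?_⟩
    filter_upwards [hwu] with p hp hpK
    rw [← hp (mem_univ _), hone p.2 ⟨p, hpK, rfl⟩, one_mul]
  · -- The two integrands cancel at almost every time, by locality and `ψ₁ φ = φ`.
    intro φ φ' hφ hφK
    rw [← eq_neg_iff_add_eq_zero, ← integral_neg]
    refine integral_congr_ae ?_
    have hae₁ := hv₁u.ae_slice
    have hae₃ := hv₃u.ae_slice
    rw [← Ioi_inter_Iio, ← Measure.restrict_restrict measurableSet_Ioi,
      ae_restrict_iff' measurableSet_Ioi] at hae₁ hae₃
    filter_upwards [hae₁, hae₃, hφK.ae_slice] with t ht₁ ht₃ htφ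
    by_cases h0 : t ∈ Ioi (0 : ℝ)
    · have hsupp : ∀ᵐ x ∂μ, x ∉ K' → E.toL2 (φ t) x = 0 := by
        filter_upwards [htφ] with x hx hxK
        exact (hx fun h => hxK ⟨_, h, rfl⟩).symm
      have hmul : h₁.mulL (φ t) = φ t := by
        refine PosForm.toL2_injective (Lp.ext ?_)
        filter_upwards [h₁.toL2_mulL (φ t), hsupp] with x hx hxφ
        rw [hx]
        by_cases hxK : x ∈ K'
        · rw [hone x hxK, one_mul]
        · rw [hxφ hxK, mul_zero]
      have hzero : E.energy (φ t) (v₁ t - v₃ t) = 0 := by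
        refine h₀.energy_eq_zero hR hL hK'c hK'C₀ hsupp ?_
        rw [map_sub]
        filter_upwards [ht₁ h0, ht₃ h0, Lp.coeFn_sub (E.toL2 (v₁ t)) (E.toL2 (v₃ t))]
          with x hx₁ hx₃ hs
        rw [hs, Pi.sub_apply, ← hx₁ (mem_univ _), ← hx₃ (mem_univ _)]
        by_cases hxψ : x ∈ tsupport ψ₀
        · rw [h₁.eq_one x hxψ, h₃.eq_one x (hsub₁₂ (h₁.subset_tsupport hxψ)), sub_self, mul_zero]
        · rw [image_eq_zero_of_notMem_tsupport hxψ, zero_mul]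
      rw [← PosForm.energyL_apply, map_sub, PosForm.energyL_apply, PosForm.energyL_apply,
        PosForm.energy_comm _ (v₁ t), PosForm.energy_comm _ (v₃ t), sub_eq_zero] at hzero
      rw [indicator_of_mem h0, indicator_of_mem h0, hFapply, hmul, hzero]
    · rw [indicator_of_notMem h0, indicator_of_notMem h0, ← PosForm.energyL_apply, map_zero]
      simp
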